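/- **Definitions.** A \emph{crossed module} $(B,D,d,\theta)$ consists of groups $B$ (written additively) and $D$ (written multiplicatively) and homomorphisms $d:B\to D$, $\theta:D\to \mathrm{Aut}(B)$ such that $\theta_{d(b)}$ is conjugation by $b$ and $d(\theta_x(b))=x\,d(b)\,x^{-1}$ for all $b\in B$, $x\in D$. Then $d(B)$ is normal in $D$, $\mathrm{Ker}\,d$ is central in $B$, and $\mathrm{Ker}\,d$ is a $\mathrm{Coker}\,d$-module through $sa=\theta_x(a)$ for $x\in s$. A morphism $(f_1,f_0):(B,D,d,\theta)\to(B',D',d',\theta')$ is a pair of group homomorphisms $f_1:B\to B'$, $f_0:D\to D'$ with $f_0d=d'f_1$ and $f_1(\theta_x b)=\theta'_{f_0(x)}f_1(b)$. The strict Gr-category $\mathbb P=\mathbb P_{B\to D}$ associated to the crossed module has the elements of $D$ as objects and $\mathrm{Hom}(x,y)=\{b\in B: x=d(b)y\}$; the composite of $x\xrightarrow{b}y\xrightarrow{c}z$ is $b+c$; the tensor product is the multiplication of $D$ on objects and $(x\xrightarrow{b}y)\otimes(x'\xrightarrow{b'}y')=(xx'\xrightarrow{b+\theta_yb'}yy')$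 on morphisms; all constraints are identities. A \emph{stick} of $\mathbb P$ is a choice of representatives $x_s\in s$ $(s\in\mathrm{Coker}\,d)$ with $x_1=1$ and of isomorphisms $i_x:x_s\to x$ for all $x\in s$, with $i_{x_s}=\mathrm{id}$ and compatible with the unit constraints. Transporting the structure of $\mathbb P$ along the isomorphisms $i_{x_s\otimes x_t}:x_{st}\to x_s\otimes x_t$ gives the \emph{reduced} Gr-category of $\mathbb P$, whose objects are the elements of $\mathrm{Coker}\,d$ and whose morphisms are the automorphisms $(s,u):s\to s$, $u\in\mathrm{Ker}\,d$. Its associativity constraint is $(srt,k(s,r,t)): s\otimes(r\otimes t)\to(s\otimes r)\otimes t$, where $k\in Z^3(\mathrm{Coker}\,d,\mathrm{Ker}\,d)$ is a $3$-cocycle. An \emph{extension of $B$ by $Q$ of type $B\to D$} is a short exact sequence of groups $0\to B\xrightarrow{j}E\xrightarrow{p}Q\to1$ with a homomorphism $\varepsilon:E\to D$ such that $(\mathrm{id}_B,\varepsilon)$ is a morphism of crossed modules from $(B,E,j,\theta')$ to $(B,D,d,\theta)$, where $\theta'$ is given by conjugation in $E$. It \emph{induces} $\psi:Q\to\mathrm{Coker}\,d$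 if $q\varepsilon=\psi p$, where $q:D\to\mathrm{Coker}\,d$ is the projection. Two such extensions are \emph{equivalent} if there is a homomorphism $\eta:E\to E'$ with $\eta j=j'$, $p'\eta=p$ and $\varepsilon'\eta=\varepsilon$. **Theorem (Brown–Mucuk).** Let $(B,D,d,\theta)$ be a crossed module, let $Q$ be a group and $\psi:Q\to\mathrm{Coker}\,d$ a group homomorphism. Let $k\in Z^3(\mathrm{Coker}\,d,\mathrm{Ker}\,d)$ be the $3$-cocycle of the reduced Gr-category of $\mathbb P_{B\to D}$ with respect to any stick, and write $H^n_\psi(Q,\mathrm{Ker}\,d)$ for the cohomology of $Q$ with coefficients in $\mathrm{Ker}\,d$, on which $Q$ acts through $\psi$. Then the vanishing of the class $\overline{\psi^*k}$ in $H^3_\psi(Q,\mathrm{Ker}\,d)$ is necessary and sufficient for there to exist an extension of $B$ by $Q$ of type $B\to D$ inducing $\psi$. Further, if $\overline{\psi^*k}$ vanishes, then the set of equivalence classes of such extensions is in bijection with $H^2_\psi(Q,\mathrm{Ker}\,d)$. -/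

import Mathlib

open CategoryTheory MonoidalCategory

universe u

/-- A crossed module `(B, D, d, θ)`; both groups are written multiplicatively. -/
structure CrossedModule (B D : Type*) [Group B] [Group D] where
  /-- the boundary map -/
  d : B →* D
  /-- the action of `D` on `B` -/
  θ : D →* MulAut B
  /-- `θ ∘ d = μ`, where `μ` is conjugation in `B` -/
  θ_d : ∀ b : B, θ (d b) = MulAut.conj b
  /-- `d (θ_x b) = μ_x (d b)` -/
  d_θ : ∀ (x : D) (b : B), d (θ x b) = x * d b * x⁻¹

namespace CrossedModule

/-- `(f₁, f₀)` is a morphism of crossed modules. -/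
structure IsHom {B D B' D' : Type*} [Group B] [Group D] [Group B'] [Group D']
    (X : CrossedModule B D) (X' : CrossedModule B' D') (f₁ : B →* B') (f₀ : D →* D') : Prop where
  comm : ∀ b : B, f₀ (X.d b) = X'.d (f₁ b)
  equivariant : ∀ (x : D) (b : B), f₁ (X.θ x b) = X'.θ (f₀ x) (f₁ b)

variable {B D : Type u} [Group B] [Group D] (X : CrossedModule B D)

/-! ### `Ker d` as a module over `Coker d` -/

instance normal_range : X.d.range.Normal where
  conj_mem := by
    rintro _ ⟨b, rfl⟩ x
    exact ⟨X.θ x b, X.d_θ x b⟩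

/-- `Coker d = D / d(B)`. -/
abbrev Coker : Type u := D ⧸ X.d.range

theorem comm_of_mem_ker {a : B} (ha : X.d a = 1) (b : B) : a * b = b * a := by
  have h := congrArg (fun f : MulAut B => f b) (X.θ_d a)
  simp only [ha, map_one, MulAut.one_apply, MulAut.conj_apply] at h
  exact (eq_mul_inv_iff_mul_eq.mp h).symm

instance commGroupKer : CommGroup X.d.ker where
  mul_comm a b := Subtype.ext (X.comm_of_mem_ker a.2 b)

/-- The action of `D` on `Ker d` by restriction of `θ`. -/
def kerAct : D →* (Additive X.d.ker →ₗ[ULift.{u} ℤ] Additive X.d.ker) where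
  toFun x :=
    { toFun := fun a => Additive.ofMul ⟨X.θ x a.toMul.1, by
        have := a.toMul.2
        rw [MonoidHom.mem_ker] at this ⊢
        rw [X.d_θ, this]; group⟩
      map_add' := fun a b => Additive.toMul.injective (Subtype.ext (map_mul (X.θ x) _ _))
      map_smul' := fun n a =>
        Additive.toMul.injective (Subtype.ext (map_zpow (X.θ x) _ n.down)) }
  map_one' := by
    ext a; simp
  map_mul' x y := by
    ext a; simp

theorem kerAct_apply (x : D) (a : Additive X.d.ker) :
    (((X.kerAct x a).toMul : X.d.ker) : B) = X.θ x a.toMul.1 := rfl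

/-- The action of `Coker d` on `Ker d`: `s a = θ_x a` for `x ∈ s`. -/
def cokerAct : Representation (ULift.{u} ℤ) X.Coker (Additive X.d.ker) :=
  QuotientGroup.lift X.d.range X.kerAct (by
    rintro _ ⟨b, rfl⟩
    ext a
    show X.θ (X.d b) a.toMul.1 = a.toMul.1
    rw [X.θ_d, MulAut.conj_apply, ← X.comm_of_mem_ker a.toMul.2, mul_inv_cancel_right])

/-- The `Coker d`-module `Ker d`. (`ULift ℤ` is the ring of integers, placed in the universe of
the groups.) -/
abbrev kerRep : Rep.{u} (ULift.{u} ℤ) X.Coker := Rep.of X.cokerAct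

/-- The action of `Coker d` on `Ker d`, in multiplicative notation. -/
def act (s : X.Coker) (u : X.d.ker) : X.d.ker := (X.cokerAct s (Additive.ofMul u)).toMul

@[simp] theorem act_mk (x : D) (u : X.d.ker) : (X.act (QuotientGroup.mk x) u).1 = X.θ x u.1 := rfl

@[simp] theorem act_one (u : X.d.ker) : X.act 1 u = u := by
  simp [act]

theorem act_mul (s t : X.Coker) (u : X.d.ker) : X.act (s * t) u = X.act s (X.act t u) := by
  simp [act]

@[simp] theorem act_map_one (s : X.Coker) : X.act s 1 = 1 := by
  simp [act]

@[simp] theorem act_map_mul (s : X.Coker) (u v : X.d.ker) :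
    X.act s (u * v) = X.act s u * X.act s v := by
  simp [act]

@[simp] theorem act_map_inv (s : X.Coker) (u : X.d.ker) : X.act s u⁻¹ = (X.act s u)⁻¹ := by
  simp [act]

/-! ### The strict Gr-category associated to a crossed module -/

/-- The objects of the Gr-category `ℙ` associated to `X`: the elements of `D`. -/
@[ext]
structure Gr (X : CrossedModule B D) where
  /-- the underlying element of `D` -/
  val : D

namespace Gr

variable {X}

/-- A morphism `x ⟶ y` of `ℙ`: an element `b ∈ B` with `x = d(b) y`. -/
@[ext]
structure Hom (x y : X.Gr) where
  /-- the underlying element of `B` -/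
  label : B
  eq : x.val = X.d label * y.val

/-- Composition is the operation of `B`; every morphism is invertible. -/
instance : Groupoid X.Gr where
  Hom := Hom
  id x := ⟨1, by simp⟩
  comp f g := ⟨f.label * g.label, by rw [f.eq, g.eq, map_mul, mul_assoc]⟩
  inv f := ⟨f.label⁻¹, by rw [f.eq, map_inv, inv_mul_cancel_left]⟩
  id_comp _ := Hom.ext (one_mul _)
  comp_id _ := Hom.ext (mul_one _)
  assoc _ _ _ := Hom.ext (mul_assoc _ _ _)
  inv_comp _ := Hom.ext (inv_mul_cancel _)
  comp_inv _ := Hom.ext (mul_inv_cancel _)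

@[ext]
theorem hom_ext {x y : X.Gr} {f g : x ⟶ y} (h : f.label = g.label) : f = g := Hom.ext h

@[simp] theorem label_id (x : X.Gr) : Hom.label (𝟙 x) = 1 := rfl

@[simp] theorem label_comp {x y z : X.Gr} (f : x ⟶ y) (g : y ⟶ z) :
    (f ≫ g).label = f.label * g.label := rfl

@[simp] theorem label_eqToHom {x y : X.Gr} (h : x = y) : (eqToHom h).label = 1 := by
  subst h; rfl

@[simp] theorem label_inv {x y : X.Gr} (f : x ≅ y) : f.inv.label = f.hom.label⁻¹ := by
  rw [eq_inv_iff_mul_eq_one, ← label_comp, f.inv_hom_id, label_id]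

/-- The tensor product: multiplication of `D` on objects, and
`(x –b→ y) ⊗ (x' –b'→ y') = (x x' –(b + θ_y b')→ y y')` on morphisms. -/
instance : MonoidalCategoryStruct X.Gr where
  tensorObj x y := ⟨x.val * y.val⟩
  tensorUnit := ⟨1⟩
  tensorHom {x y x' y'} f g := ⟨f.label * X.θ y.val g.label, by
    simp only [map_mul, X.d_θ]
    rw [f.eq, g.eq]; group⟩
  whiskerLeft x {y y'} g := ⟨X.θ x.val g.label, by
    simp only [X.d_θ]
    rw [g.eq]; group⟩
  whiskerRight {x x'} f y := ⟨f.label, by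
    show x.val * y.val = X.d f.label * (x'.val * y.val)
    rw [f.eq, mul_assoc]⟩
  associator x y z := eqToIso (Gr.ext (mul_assoc _ _ _))
  leftUnitor x := eqToIso (Gr.ext (one_mul _))
  rightUnitor x := eqToIso (Gr.ext (mul_one _))

@[simp] theorem val_tensor (x y : X.Gr) : (x ⊗ y).val = x.val * y.val := rfl

@[simp] theorem val_unit : (𝟙_ X.Gr).val = 1 := rfl

@[simp] theorem label_tensorHom {x y x' y' : X.Gr} (f : x ⟶ y) (g : x' ⟶ y') :
    (f ⊗ₘ g).label = f.label * X.θ y.val g.label := rfl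

@[simp] theorem label_whiskerLeft (x : X.Gr) {y z : X.Gr} (f : y ⟶ z) :
    (x ◁ f).label = X.θ x.val f.label := rfl

@[simp] theorem label_whiskerRight {x y : X.Gr} (f : x ⟶ y) (z : X.Gr) :
    (f ▷ z).label = f.label := rfl

@[simp] theorem label_associator_hom (x y z : X.Gr) : (α_ x y z).hom.label = 1 :=
  label_eqToHom (Gr.ext (mul_assoc _ _ _))

@[simp] theorem label_leftUnitor_hom (x : X.Gr) : (λ_ x).hom.label = 1 :=
  label_eqToHom (Gr.ext (one_mul _))

@[simp] theorem label_rightUnitor_hom (x : X.Gr) : (ρ_ x).hom.label = 1 :=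
  label_eqToHom (Gr.ext (mul_one _))

theorem θ_mul_label {x y : X.Gr} (f : x ⟶ y) (b : B) :
    X.θ x.val b * f.label = f.label * X.θ y.val b := by
  rw [f.eq, map_mul, X.θ_d, MulAut.mul_apply, MulAut.conj_apply, inv_mul_cancel_right]

/-- The associated strict Gr-category: the constraints are identities. -/
instance : MonoidalCategory X.Gr where
  tensorHom_def f g := by ext; simp
  id_tensorHom_id x y := by ext; simp
  tensorHom_comp_tensorHom {x₁ y₁ z₁ x₂ y₂ z₂} f₁ f₂ g₁ g₂ := by
    ext
    have h := θ_mul_label g₁ (f₂.label)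
    simp only [label_tensorHom, label_comp, map_mul]
    rw [mul_assoc, ← mul_assoc (X.θ _ _) g₁.label, h]
    simp only [mul_assoc]
  whiskerLeft_id x y := by ext; simp
  id_whiskerRight x y := by ext; simp
  associator_naturality f g h := by ext; simp [mul_assoc]
  leftUnitor_naturality f := by ext; simp
  rightUnitor_naturality f := by ext; simp
  pentagon x y z w := by ext; simp
  triangle x y := by ext; simp

/-- The class `[x] ∈ π₀ ℙ = Coker d` of an object. -/
def cls (x : X.Gr) : X.Coker := QuotientGroup.mk x.val

@[simp] theorem cls_tensor (x y : X.Gr) : (x ⊗ y).cls = x.cls * y.cls := rfl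

@[simp] theorem cls_unit : (𝟙_ X.Gr).cls = 1 := rfl

/-- `π₀ ℙ = Coker d`: two objects are isomorphic iff they have the same class. -/
theorem cls_eq_iff (x y : X.Gr) : x.cls = y.cls ↔ Nonempty (x ≅ y) := by
  constructor
  · intro h
    have h' : (QuotientGroup.mk y.val : X.Coker) = QuotientGroup.mk x.val := h.symm
    obtain ⟨b, hb⟩ := QuotientGroup.eq.mp h'
    refine ⟨(Groupoid.isoEquivHom x y).symm ⟨X.θ y.val b, ?_⟩⟩
    rw [X.d_θ, hb]; group
  · rintro ⟨f⟩
    refine (QuotientGroup.eq.mpr ⟨(X.θ x.val⁻¹) f.hom.label⁻¹, ?_⟩)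
    rw [X.d_θ, f.hom.eq]; simp

/-- `π₁ ℙ = Ker d`: the automorphism of the unit object with a given label. -/
def unitEnd (u : X.d.ker) : 𝟙_ X.Gr ⟶ 𝟙_ X.Gr :=
  ⟨u.1, by rw [MonoidHom.mem_ker.mp u.2, one_mul]⟩

theorem unitEnd_bijective :
    Function.Bijective (unitEnd : X.d.ker → (𝟙_ X.Gr ⟶ 𝟙_ X.Gr)) :=
  ⟨fun _ _ h => Subtype.ext (congrArg Hom.label h),
    fun f => ⟨⟨f.label, by
      have h := f.eq
      rwa [right_eq_mul, ← MonoidHom.mem_ker] at h⟩, rfl⟩⟩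

/-- `γ_x(u) : x ⟶ x`, obtained from `u ⊗ x` through the left unit constraint. -/
def gamma (x : X.Gr) (u : X.d.ker) : x ⟶ x := (λ_ x).inv ≫ unitEnd u ▷ x ≫ (λ_ x).hom

/-- `δ_x(u) : x ⟶ x`, obtained from `x ⊗ u` through the right unit constraint. -/
def delta (x : X.Gr) (u : X.d.ker) : x ⟶ x := (ρ_ x).inv ≫ x ◁ unitEnd u ≫ (ρ_ x).hom

@[simp] theorem label_gamma (x : X.Gr) (u : X.d.ker) : (gamma x u).label = u.1 := by
  simp [gamma, unitEnd]

@[simp] theorem label_delta (x : X.Gr) (u : X.d.ker) : (delta x u).label = X.θ x.val u.1 := by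
  simp [delta, unitEnd]

theorem gamma_bijective (x : X.Gr) : Function.Bijective (gamma x) := by
  constructor
  · intro u v h
    apply Subtype.ext
    have := congrArg Hom.label h
    simpa only [label_gamma] using this
  · intro f
    refine ⟨⟨f.label, ?_⟩, by ext; simp⟩
    have h := f.eq
    rwa [right_eq_mul, ← MonoidHom.mem_ker] at h

/-- The action of `π₀ ℙ` on `π₁ ℙ`, `[x] u = γ_x⁻¹ (δ_x u)`, is that of `Coker d` on `Ker d`. -/
theorem gamma_act (x : X.Gr) (u : X.d.ker) :
    gamma x (X.act x.cls u) = delta x u := by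
  ext
  simp only [label_gamma, label_delta]
  rfl

end Gr

/-! ### Sticks and the reduced Gr-category -/

/-- A stick `(x_s, i_x)` of `ℙ`: representatives `x_s ∈ s` with `x_1 = I`, and isomorphisms
`i_x : x_s ⟶ x` for `x ∈ s`, with `i_{x_s} = id` and compatible with the unit constraints. -/
structure Stick where
  /-- the representative `x_s` -/
  obj : X.Coker → X.Gr
  cls_obj : ∀ s, (obj s).cls = s
  /-- the isomorphism `i_x` -/
  iso : ∀ x : X.Gr, obj x.cls ≅ x
  obj_one : obj 1 = 𝟙_ X.Gr
  iso_obj : ∀ s, (iso (obj s)).hom = eqToHom (by rw [cls_obj])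
  iso_unit_tensor : ∀ s, (iso (𝟙_ X.Gr ⊗ obj s)).hom =
    eqToHom (by rw [Gr.cls_tensor, Gr.cls_unit, one_mul, cls_obj]) ≫ (λ_ (obj s)).inv
  iso_tensor_unit : ∀ s, (iso (obj s ⊗ 𝟙_ X.Gr)).hom =
    eqToHom (by rw [Gr.cls_tensor, Gr.cls_unit, mul_one, cls_obj]) ≫ (ρ_ (obj s)).inv

namespace Stick

variable {X} (σ : X.Stick)

/-- `i_{x_s ⊗ x_t} : x_{st} ⟶ x_s ⊗ x_t`; its inverse is the monoidal constraint of `H`. -/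
def mu (s t : X.Coker) : σ.obj (s * t) ≅ σ.obj s ⊗ σ.obj t :=
  eqToIso (by rw [Gr.cls_tensor, σ.cls_obj, σ.cls_obj]) ≪≫ σ.iso (σ.obj s ⊗ σ.obj t)

/-- The associativity constraint `x_s ⊗ (x_r ⊗ x_t) ⟶ (x_s ⊗ x_r) ⊗ x_t` of `ℙ`, transported to an
automorphism of `x_{srt}` along the isomorphisms `x_{st} ⟶ x_s ⊗ x_t`. -/
def assocEnd (s r t : X.Coker) : σ.obj (s * r * t) ⟶ σ.obj (s * r * t) :=
  eqToHom (by rw [mul_assoc]) ≫ (σ.mu s (r * t)).hom ≫ σ.obj s ◁ (σ.mu r t).hom ≫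
    (α_ (σ.obj s) (σ.obj r) (σ.obj t)).inv ≫ (σ.mu s r).inv ▷ σ.obj t ≫ (σ.mu (s * r) t).inv

/-- The function `k`: the associativity constraint of the reduced Gr-category is
`a_{s,r,t} = (srt, k(s,r,t))`, where `γ_{x_{srt}}(k(s,r,t))` is the transported constraint. -/
noncomputable def k (s r t : X.Coker) : X.d.ker :=
  (Equiv.ofBijective _ (Gr.gamma_bijective (σ.obj (s * r * t)))).symm (σ.assocEnd s r t)

theorem gamma_k (s r t : X.Coker) :
    Gr.gamma (σ.obj (s * r * t)) (σ.k s r t) = σ.assocEnd s r t :=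
  (Equiv.ofBijective _ (Gr.gamma_bijective (σ.obj (s * r * t)))).apply_symm_apply _

/-- The label `m(s,t) ∈ B` of `i_{x_s ⊗ x_t}`. -/
def lab (s t : X.Coker) : B := (σ.mu s t).hom.label

theorem act_eq (s : X.Coker) (u : X.d.ker) : (X.act s u).1 = X.θ (σ.obj s).val u.1 := by
  conv_lhs => rw [← σ.cls_obj s]
  rfl

theorem lab_eq (s t : X.Coker) :
    (σ.obj (s * t)).val = X.d (σ.lab s t) * ((σ.obj s).val * (σ.obj t).val) :=
  (σ.mu s t).hom.eq

theorem k_mul (s r t : X.Coker) :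
    (σ.k s r t).1 * (σ.lab (s * r) t * σ.lab s r) =
      σ.lab s (r * t) * X.θ (σ.obj s).val (σ.lab r t) := by
  have h := congrArg Gr.Hom.label (σ.gamma_k s r t)
  simp only [Gr.label_gamma, assocEnd, Gr.label_comp, Gr.label_eqToHom, Gr.label_whiskerLeft,
    Gr.label_inv, Gr.label_whiskerRight, Gr.label_associator_hom] at h
  rw [h]
  simp only [lab]
  group

theorem k_cocycle (s r t v : X.Coker) :
    X.act s (σ.k r t v) * σ.k s (r * t) v * σ.k s r t = σ.k (s * r) t v * σ.k s r (t * v) := by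
  apply Subtype.ext
  apply mul_right_cancel (b := σ.lab (s * r * t) v * σ.lab (s * r) t * σ.lab s r)
  have e1 := congrArg (X.θ (σ.obj s).val) (σ.k_mul r t v)
  have e2 := σ.k_mul s (r * t) v
  have e3 := σ.k_mul s r t
  have e4 := σ.k_mul (s * r) t v
  have e5 := σ.k_mul s r (t * v)
  have e6 : σ.lab s r * X.θ (σ.obj s).val (X.θ (σ.obj r).val (σ.lab t v)) =
      X.θ (σ.obj (s * r)).val (σ.lab t v) * σ.lab s r := by
    rw [σ.lab_eq s r]
    simp only [map_mul, X.θ_d, MulAut.mul_apply, MulAut.conj_apply]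
    group
  have c1 : ∀ b, b * X.θ (σ.obj s).val (σ.k r t v) = X.θ (σ.obj s).val (σ.k r t v) * b := by
    intro b
    rw [← σ.act_eq]
    exact (X.comm_of_mem_ker (X.act s (σ.k r t v)).2 b).symm
  have c2 : ∀ b, b * (σ.k s r t).1 = (σ.k s r t).1 * b := fun b =>
    (X.comm_of_mem_ker (σ.k s r t).2 b).symm
  have c3 : ∀ b, b * (σ.k s r (t * v)).1 = (σ.k s r (t * v)).1 * b := fun b =>
    (X.comm_of_mem_ker (σ.k s r (t * v)).2 b).symm
  simp only [map_mul] at e1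
  simp only [mul_assoc] at e1 e2 e3 e4 e5
  calc ((X.act s (σ.k r t v) * σ.k s (r * t) v * σ.k s r t : X.d.ker) : B) *
        (σ.lab (s * r * t) v * σ.lab (s * r) t * σ.lab s r)
      = X.θ (σ.obj s).val (σ.k r t v) * ((σ.k s (r * t) v).1 *
          (((σ.k s r t).1 * σ.lab (s * (r * t)) v) * (σ.lab (s * r) t * σ.lab s r))) := by
        simp only [Subgroup.coe_mul, σ.act_eq, mul_assoc]
    _ = X.θ (σ.obj s).val (σ.k r t v) * (((σ.k s (r * t) v).1 *
          (σ.lab (s * (r * t)) v * σ.lab s (r * t))) * X.θ (σ.obj s).val (σ.lab r t)) := by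
        rw [← c2, mul_assoc _ (σ.k s r t).1, e3]; simp only [mul_assoc]
    _ = X.θ (σ.obj s).val (σ.k r t v) * (σ.lab s (r * (t * v)) *
          (X.θ (σ.obj s).val (σ.lab (r * t) v) * X.θ (σ.obj s).val (σ.lab r t))) := by
        rw [e2]; simp only [mul_assoc]
    _ = σ.lab s (r * (t * v)) * (X.θ (σ.obj s).val (σ.lab r (t * v)) *
          X.θ (σ.obj s).val (X.θ (σ.obj r).val (σ.lab t v))) := by
        rw [← mul_assoc, ← c1, mul_assoc, e1]
    _ = (σ.k s r (t * v)).1 * (σ.lab (s * r) (t * v) *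
          (X.θ (σ.obj (s * r)).val (σ.lab t v) * σ.lab s r)) := by
        rw [← mul_assoc, ← e5, ← e6]; simp only [mul_assoc]
    _ = (σ.k s r (t * v)).1 * ((σ.k (s * r) t v).1 *
          (σ.lab (s * (r * t)) v * σ.lab (s * r) t * σ.lab s r)) := by
        congr 1
        calc _ = (σ.k (s * r) t v).1 * (σ.lab (s * (r * t)) v * σ.lab (s * r) t) * σ.lab s r := by
              rw [e4]; simp only [mul_assoc]
          _ = _ := by simp only [mul_assoc]
    _ = _ := by
        rw [← mul_assoc, ← c3]; simp only [Subgroup.coe_mul, mul_assoc]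

@[simp] theorem lab_one_left (s : X.Coker) : σ.lab 1 s = 1 := by
  have h : ∀ x : X.Gr, x = 𝟙_ X.Gr ⊗ σ.obj s → (σ.iso x).hom.label = 1 := by
    rintro x rfl
    rw [σ.iso_unit_tensor, Gr.label_comp, Gr.label_eqToHom, Gr.label_inv,
      Gr.label_leftUnitor_hom, inv_one, mul_one]
  simp only [lab, mu, Iso.trans_hom, eqToIso.hom, Gr.label_comp, Gr.label_eqToHom, one_mul]
  exact h _ (by rw [σ.obj_one])

@[simp] theorem lab_one_right (s : X.Coker) : σ.lab s 1 = 1 := by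
  have h : ∀ x : X.Gr, x = σ.obj s ⊗ 𝟙_ X.Gr → (σ.iso x).hom.label = 1 := by
    rintro x rfl
    rw [σ.iso_tensor_unit, Gr.label_comp, Gr.label_eqToHom, Gr.label_inv,
      Gr.label_rightUnitor_hom, inv_one, mul_one]
  simp only [lab, mu, Iso.trans_hom, eqToIso.hom, Gr.label_comp, Gr.label_eqToHom, one_mul]
  exact h _ (by rw [σ.obj_one])

theorem k_one_mid (s t : X.Coker) : σ.k s 1 t = 1 := by
  apply Subtype.ext
  have h := σ.k_mul s 1 t
  simp only [lab_one_left, lab_one_right, map_one, one_mul, mul_one] at h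
  exact mul_eq_right.mp h

/-- Sticks exist. -/
instance : Nonempty X.Stick := by
  classical
  let o : X.Coker → X.Gr := fun s => if s = 1 then 𝟙_ X.Gr else ⟨Quotient.out s⟩
  have ho : ∀ s, (o s).cls = s := by
    intro s
    by_cases h : s = 1
    · simp [o, h]
    · simp only [o, h, if_false, Gr.cls]
      exact Quotient.out_eq s
  let i : ∀ x : X.Gr, o x.cls ≅ x := fun x =>
    if h : o x.cls = x then eqToIso h else ((Gr.cls_eq_iff _ _).mp (ho x.cls)).some
  have hi : ∀ x : X.Gr, o x.cls = x → (i x).hom.label = 1 := by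
    intro x h
    simp [i, h]
  refine ⟨⟨o, ho, i, by simp [o], fun s => ?_, fun s => ?_, fun s => ?_⟩⟩
  · ext
    rw [Gr.label_eqToHom, hi _ (by rw [ho])]
  · ext
    rw [hi _ ?_, Gr.label_comp, Gr.label_eqToHom, Gr.label_inv, Gr.label_leftUnitor_hom]
    · simp
    · rw [Gr.cls_tensor, Gr.cls_unit, one_mul, ho]
      exact Gr.ext (one_mul _).symm
  · ext
    rw [hi _ ?_, Gr.label_comp, Gr.label_eqToHom, Gr.label_inv, Gr.label_rightUnitor_hom]
    · simp
    · rw [Gr.cls_tensor, Gr.cls_unit, mul_one, ho]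
      exact Gr.ext (mul_one _).symm

/-- The objects of the reduced Gr-category `S_ℙ` with respect to `σ`: the elements of `Coker d`. -/
@[ext]
structure Red (σ : X.Stick) where
  /-- the underlying element of `Coker d` -/
  val : X.Coker

namespace Red

variable {σ}

/-- The morphisms of `S_ℙ`: only automorphisms `(s, u) : s ⟶ s` with `u ∈ Ker d`. -/
@[ext]
structure Hom (s t : σ.Red) where
  /-- the element of `Ker d` -/
  label : X.d.ker
  eq : s = t

/-- Composition is the operation of `Ker d`. -/
instance : Groupoid σ.Red where
  Hom := Hom
  id _ := ⟨1, rfl⟩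
  comp f g := ⟨f.label * g.label, f.eq.trans g.eq⟩
  inv f := ⟨f.label⁻¹, f.eq.symm⟩
  id_comp _ := Hom.ext (one_mul _)
  comp_id _ := Hom.ext (mul_one _)
  assoc _ _ _ := Hom.ext (mul_assoc _ _ _)
  inv_comp _ := Hom.ext (inv_mul_cancel _)
  comp_inv _ := Hom.ext (mul_inv_cancel _)

@[ext]
theorem hom_ext {s t : σ.Red} {f g : s ⟶ t} (h : f.label = g.label) : f = g := Hom.ext h

@[simp] theorem label_id (s : σ.Red) : Hom.label (𝟙 s) = 1 := rfl

@[simp] theorem label_comp {s t r : σ.Red} (f : s ⟶ t) (g : t ⟶ r) :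
    (f ≫ g).label = f.label * g.label := rfl

/-- The isomorphism with a given label. -/
def mkIso {s t : σ.Red} (u : X.d.ker) (h : s = t) : s ≅ t where
  hom := ⟨u, h⟩
  inv := ⟨u⁻¹, h.symm⟩
  hom_inv_id := Hom.ext (mul_inv_cancel _)
  inv_hom_id := Hom.ext (inv_mul_cancel _)

/-- The tensor product `s ⊗ t = st`, `(s, u) ⊗ (t, v) = (st, u + s v)`; the unit constraints are
strict and the associativity constraint `s ⊗ (r ⊗ t) ⟶ (s ⊗ r) ⊗ t` is `(srt, k(s,r,t))`. -/
noncomputable instance : MonoidalCategoryStruct σ.Red where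
  tensorObj s t := ⟨s.val * t.val⟩
  tensorUnit := ⟨1⟩
  tensorHom {s _ t _} f g := ⟨f.label * X.act s.val g.label, by rw [f.eq, g.eq]⟩
  whiskerLeft s _ _ g := ⟨X.act s.val g.label, by rw [g.eq]⟩
  whiskerRight f t := ⟨f.label, by rw [f.eq]⟩
  associator s r t := (mkIso (σ.k s.val r.val t.val)
    (Stick.Red.ext (mul_assoc s.val r.val t.val).symm)).symm
  leftUnitor s := mkIso 1 (Stick.Red.ext (one_mul s.val))
  rightUnitor s := mkIso 1 (Stick.Red.ext (mul_one s.val))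

@[simp] theorem val_tensor (s t : σ.Red) : (s ⊗ t).val = s.val * t.val := rfl

@[simp] theorem val_unit : (𝟙_ σ.Red).val = 1 := rfl

@[simp] theorem label_tensorHom {x y x' y' : σ.Red} (f : x ⟶ y) (g : x' ⟶ y') :
    (f ⊗ₘ g).label = f.label * X.act x.val g.label := rfl

@[simp] theorem label_whiskerLeft (x : σ.Red) {y z : σ.Red} (f : y ⟶ z) :
    (x ◁ f).label = X.act x.val f.label := rfl

@[simp] theorem label_whiskerRight {x y : σ.Red} (f : x ⟶ y) (z : σ.Red) :
    (f ▷ z).label = f.label := rfl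

@[simp] theorem label_associator_inv (s r t : σ.Red) :
    (α_ s r t).inv.label = σ.k s.val r.val t.val := rfl

@[simp] theorem label_associator_hom (s r t : σ.Red) :
    (α_ s r t).hom.label = (σ.k s.val r.val t.val)⁻¹ := rfl

@[simp] theorem label_leftUnitor_hom (s : σ.Red) : (λ_ s).hom.label = 1 := rfl

@[simp] theorem label_rightUnitor_hom (s : σ.Red) : (ρ_ s).hom.label = 1 := rfl

/-- The reduced Gr-category `S_ℙ = (Coker d, Ker d, k)`. -/
noncomputable instance : MonoidalCategory σ.Red where
  tensorHom_def {s t s' t'} f g := by obtain rfl := f.eq; ext; simp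
  id_tensorHom_id x y := by ext; simp
  tensorHom_comp_tensorHom {x₁ y₁ z₁ x₂ y₂ z₂} f₁ f₂ g₁ g₂ := by
    obtain rfl := f₁.eq
    ext
    simp [mul_mul_mul_comm]
  whiskerLeft_id x y := by ext; simp
  id_whiskerRight x y := by ext; simp
  associator_naturality {x₁ x₂ x₃ y₁ y₂ y₃} f₁ f₂ f₃ := by
    obtain rfl := f₁.eq
    obtain rfl := f₂.eq
    obtain rfl := f₃.eq
    ext
    simp [X.act_mul, mul_assoc, mul_comm, mul_left_comm]
  leftUnitor_naturality f := by ext; simp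
  rightUnitor_naturality f := by ext; simp
  pentagon s r t v := by
    have h := σ.k_cocycle s.val r.val t.val v.val
    apply hom_ext
    simp only [label_comp, label_whiskerLeft, label_whiskerRight, label_associator_hom,
      val_tensor, act_map_inv, ← mul_inv, inv_inj]
    rw [← h, mul_comm, mul_comm (σ.k _ _ _)]
  triangle s t := by ext; simp [σ.k_one_mid]

/-- The canonical functor `H : S_ℙ ⥤ ℙ`, `H(s) = x_s`, `H(s, u) = γ_{x_s}(u)`. -/
def canonical (σ : X.Stick) : σ.Red ⥤ X.Gr where
  obj s := σ.obj s.val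
  map {s t} f := Gr.gamma (σ.obj s.val) f.label ≫ eqToHom (by rw [f.eq])
  map_id s := by ext; simp
  map_comp f g := by ext; simp

@[simp] theorem label_canonical_map {s t : σ.Red} (f : s ⟶ t) :
    ((canonical σ).map f).label = f.label.1 := by
  simp [canonical]

instance : (canonical σ).IsEquivalence where
  faithful := ⟨fun {s t f g} h => by
    have := congrArg Gr.Hom.label h
    simp only [label_canonical_map] at this
    exact hom_ext (Subtype.ext this)⟩
  full := ⟨fun {s t} f => by
    have h : s = t := by
      have h := (Gr.cls_eq_iff _ _).mpr ⟨(Groupoid.isoEquivHom _ _).symm f⟩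
      simp only [canonical, σ.cls_obj] at h
      exact Stick.Red.ext h
    subst h
    obtain ⟨u, hu⟩ := (Gr.gamma_bijective _).2 f
    exact ⟨⟨u, rfl⟩, by ext; simp [← hu]⟩⟩
  essSurj := ⟨fun x => ⟨⟨x.cls⟩, ⟨σ.iso x⟩⟩⟩

/-- `H` with the constraints `i_{x_s ⊗ x_t}⁻¹` is a monoidal functor, so that `S_ℙ` carries the
monoidal structure transported from `ℙ`. -/
noncomputable def canonicalMonoidal (σ : X.Stick) : (canonical σ).CoreMonoidal where
  εIso := eqToIso σ.obj_one.symm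
  μIso s t := (σ.mu s.val t.val).symm
  μIso_hom_natural_left {s t} f r := by
    obtain rfl := f.eq
    ext
    simp [canonical]
    exact X.comm_of_mem_ker f.label.2 _
  μIso_hom_natural_right {s t} r f := by
    obtain rfl := f.eq
    ext
    simp [canonical]
    rw [← σ.act_eq]
    exact X.comm_of_mem_ker (X.act r.val f.label).2 _
  associativity s r t := by
    ext
    simp [canonical]
    have h := congrArg (fun b => b⁻¹) (σ.k_mul s.val r.val t.val)
    simp only [mul_inv_rev, lab] at h
    rw [← mul_assoc, h]
  left_unitality s := by
    ext
    simp [canonical]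
    exact σ.lab_one_left s.val
  right_unitality s := by
    ext
    simp [canonical]
    exact σ.lab_one_right s.val

end Red

end Stick

/-- `k` as an inhomogeneous 3-cocycle of `Coker d` with coefficients in `Ker d`. -/
noncomputable def Stick.cocycle {X : CrossedModule B D} (σ : X.Stick) :
    groupCohomology.cocycles X.kerRep 3 :=
  groupCohomology.cocyclesMk
    (fun g => (Additive.ofMul (σ.k (g 0) (g 1) (g 2)) : Additive X.d.ker)) (by
    funext g
    have h : X.cokerAct (g 0) (Additive.ofMul (σ.k (g 1) (g 2) (g 3))) +
        Additive.ofMul (σ.k (g 0) (g 1 * g 2) (g 3)) + Additive.ofMul (σ.k (g 0) (g 1) (g 2)) =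
        Additive.ofMul (σ.k (g 0 * g 1) (g 2) (g 3)) +
        Additive.ofMul (σ.k (g 0) (g 1) (g 2 * g 3)) :=
      congrArg Additive.ofMul (σ.k_cocycle (g 0) (g 1) (g 2) (g 3))
    rw [inhomogeneousCochains.d_hom_apply]
    refine (congrArg _ (Fin.sum_univ_four _)).trans ?_
    generalize h₁ : (X.cokerAct (g 0)) (Additive.ofMul (σ.k (g 1) (g 2) (g 3))) = a at h
    show (X.cokerAct (g 0)) (Additive.ofMul (σ.k (g 1) (g 2) (g 3))) + (
      (-1 : ULift.{u} ℤ) ^ 1 • Additive.ofMul (σ.k (g 0 * g 1) (g 2) (g 3)) +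
      (-1 : ULift.{u} ℤ) ^ 2 • Additive.ofMul (σ.k (g 0) (g 1 * g 2) (g 3)) +
      (-1 : ULift.{u} ℤ) ^ 3 • Additive.ofMul (σ.k (g 0) (g 1) (g 2 * g 3)) +
      (-1 : ULift.{u} ℤ) ^ 4 • Additive.ofMul (σ.k (g 0) (g 1) (g 2))) = 0
    rw [h₁, eq_sub_of_add_eq (eq_sub_of_add_eq h)]
    have e₁ : (-1 : ULift.{u} ℤ) ^ 3 = -1 := by ring
    have e₂ : (-1 : ULift.{u} ℤ) ^ 4 = 1 := by ring
    rw [e₁, e₂, pow_one, neg_one_sq]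
    simp only [neg_smul, one_smul]
    abel)

variable {Q : Type u} [Group Q]

/-- `Ker d` as a `Q`-module through `ψ : Q → Coker d`. -/
abbrev kerRes (ψ : Q →* X.Coker) : Rep.{u} (ULift.{u} ℤ) Q := Rep.res ψ X.kerRep

/-- The class of `ψ*k` in `H³_ψ(Q, Ker d)`. -/
noncomputable def obstruction {X : CrossedModule B D} (σ : X.Stick) (ψ : Q →* X.Coker) :
    groupCohomology (X.kerRes ψ) 3 :=
  groupCohomology.π (X.kerRes ψ) 3
    (groupCohomology.cocyclesMap ψ (𝟙 (X.kerRes ψ)) 3 σ.cocycle)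

/-! ### Extensions of the type of a crossed module -/

/-- For an exact sequence `1 → B → E → Q → 1`, the crossed module `(B, E, j, θ')` in which `θ'` is
given by conjugation in `E`. -/
noncomputable def ofGroupExtension {E : Type u} [Group E] (S : GroupExtension B E Q) :
    CrossedModule B E where
  d := S.inl
  θ := S.conjAct
  θ_d b := by
    ext c
    apply S.inl_injective
    simp [S.inl_conjAct_comm]
  d_θ _ _ := S.inl_conjAct_comm

/-- An extension of `B` by `Q` of type `d : B → D`. -/
structure Extension (X : CrossedModule B D) (Q : Type u) [Group Q] where
  /-- the middle group -/
  E : Type u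
  [group : Group E]
  /-- the exact sequence `1 → B → E → Q → 1` -/
  seq : GroupExtension B E Q
  /-- the homomorphism to `D` -/
  ε : E →* D
  isHom : (ofGroupExtension seq).IsHom X (MonoidHom.id B) ε

namespace Extension

attribute [instance] Extension.group

variable {X}

/-- `ℰ` induces `ψ`: `q ∘ ε = ψ ∘ p`. -/
def Induces (ℰ : X.Extension Q) (ψ : Q →* X.Coker) : Prop :=
  ∀ e : ℰ.E, (QuotientGroup.mk (ℰ.ε e) : X.Coker) = ψ (ℰ.seq.rightHom e)

/-- Equivalence of extensions of type `d : B → D`. -/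
def Equivalent (ℰ ℰ' : X.Extension Q) : Prop :=
  ∃ η : ℰ.E →* ℰ'.E, (∀ b, η (ℰ.seq.inl b) = ℰ'.seq.inl b) ∧
    (∀ e, ℰ'.seq.rightHom (η e) = ℰ.seq.rightHom e) ∧ ∀ e, ℰ'.ε (η e) = ℰ.ε e

theorem Equivalent.symm {ℰ ℰ' : X.Extension Q} (h : Equivalent ℰ ℰ') : Equivalent ℰ' ℰ := by
  obtain ⟨η, h₁, h₂, h₃⟩ := h
  let e : ℰ.seq.Equiv ℰ'.seq :=
    GroupExtension.Equiv.ofMonoidHom η (by ext; simp [h₁]) (by ext; simp [h₂])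
  have he : ∀ x, e x = η x := fun _ => rfl
  have hs : ∀ y, ∃ x, η x = y ∧ e.symm y = x := fun y =>
    ⟨e.symm y, e.toMulEquiv.apply_symm_apply y, rfl⟩
  refine ⟨e.symm.toMulEquiv.toMonoidHom, fun b => e.symm.map_inl b, fun y => e.symm.rightHom_map y,
    fun y => ?_⟩
  obtain ⟨x, rfl, hx⟩ := hs y
  rw [h₃]
  exact congrArg ℰ.ε hx

end Extension

/-- The extensions of `B` by `Q` of type `d : B → D` inducing `ψ`. -/
abbrev ExtInducing (ψ : Q →* X.Coker) : Type (u + 1) :=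
  {ℰ : X.Extension Q // ℰ.Induces ψ}

instance extSetoid (ψ : Q →* X.Coker) : Setoid (X.ExtInducing ψ) where
  r ℰ ℰ' := ℰ.1.Equivalent ℰ'.1
  iseqv :=
    { refl := fun _ => ⟨MonoidHom.id _, fun _ => rfl, fun _ => rfl, fun _ => rfl⟩
      symm := Extension.Equivalent.symm
      trans := by
        rintro _ _ _ ⟨η, h₁, h₂, h₃⟩ ⟨η', h₁', h₂', h₃'⟩
        exact ⟨η'.comp η, fun b => by simp [h₁, h₁'], fun e => by simp [h₂, h₂'],
          fun e => by simp [h₃, h₃']⟩ }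

/-- `Ext_{B → D}(Q, B, ψ)`: the equivalence classes of extensions inducing `ψ`. -/
abbrev Ext (ψ : Q →* X.Coker) : Type (u + 1) := Quotient (X.extSetoid ψ)

end CrossedModule

/-! Let `ℰ` be an extension inducing `ψ`. Because `ε` induces `ψ`, there is a set-theoretic section
`e` of `E → Q` with `ε (e q) = x_{ψ q}`. Write `e p * e q = j (f p q) * e (p * q)`. Applying `ε`
shows that `d (f p q)` carries `x_{ψ(pq)}` to `x_{ψ p} x_{ψ q}`. The inverse of the stick label `m(ψ
p, ψ q)` does the same, so `f = m⁻¹ u` with `u` valued in the central subgroup `Ker d`.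
Associativity in `E` is the Schreier identity for `f`. The cocycle `k` measures the failure of `m`
to satisfy that identity (`Stick.k_mul`), so the identity for `f` becomes `du = ψ*k`
(`schreier_iff`). Conversely, any such `u` makes `B × Q` into an extension (`FactorSet.extension`).
Hence extensions exist iff `ψ*k` is a coboundary.

For the classification, fix one solution `v` of `dv = ψ*k`; the solutions are then `v + z` with `z`
a 2-cocycle. Two sections over the same representatives differ by a map `h : Q → Ker d`, and passing
from one to the other changes `u` by the coboundary of `h`. Since an extension is recovered up to
equivalence from its factor set (`Realizes.equivalent`), equivalence of extensions is cohomology of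
the `u` (`Realizes.equivalent_iff`). So `ℰ ↦ [u - v]` is the bijection with `H²`; it depends on `v`.
-/

namespace CrossedModule

variable {B D : Type u} [Group B] [Group D] {X : CrossedModule B D}

/-! ### Factor sets and the extensions they define -/

/-- A factor set of type `X`: a family `y : Q → D`, multiplicative up to `d ∘ f`, where
`f : Q × Q → B` satisfies the Schreier cocycle identity. -/
structure FactorSet (X : CrossedModule B D) (Q : Type u) [Group Q] where
  /-- the representatives in `D` -/
  y : Q → D
  /-- the factors in `B` -/
  f : Q → Q → B
  y_one : y 1 = 1
  y_mul : ∀ p q, y p * y q = X.d (f p q) * y (p * q)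
  f_mul : ∀ p q r, f p q * f (p * q) r = X.θ (y p) (f q r) * f p (q * r)

namespace FactorSet

variable {Q : Type u} [Group Q] (F : FactorSet X Q)

theorem f_one_left (q : Q) : F.f 1 q = F.f 1 1 := by
  have h := F.f_mul 1 1 q
  simpa [F.y_one] using h.symm

theorem f_one_right (p : Q) : F.f p 1 = X.θ (F.y p) (F.f 1 1) := by
  have h := F.f_mul p 1 1
  simpa using h

theorem d_f_one : X.d (F.f 1 1) = 1 := by
  have h := F.y_mul 1 1
  simpa [F.y_one] using h.symm

theorem f_one_comm (b : B) : F.f 1 1 * b = b * F.f 1 1 :=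
  X.comm_of_mem_ker F.d_f_one b

/-- The family `y` acts on `B` only up to conjugation by the factors, because `θ ∘ d` is
conjugation. -/
theorem θ_y_y (p q : Q) (b : B) :
    X.θ (F.y p) (X.θ (F.y q) b) = F.f p q * X.θ (F.y (p * q)) b * (F.f p q)⁻¹ := by
  rw [← MulAut.mul_apply, ← map_mul, F.y_mul, map_mul, X.θ_d, MulAut.mul_apply, MulAut.conj_apply]

/-- The group defined by a factor set. -/
@[ext]
structure Grp (F : FactorSet X Q) where
  /-- the component in `B` -/
  left : B
  /-- the component in `Q` -/
  right : Q

instance : Mul F.Grp := ⟨fun a b => ⟨a.left * X.θ (F.y a.right) b.left * F.f a.right b.right,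
  a.right * b.right⟩⟩

/-- Factors are not normalized, because inhomogeneous cochains are not. The unit, the inverses and
the inclusion of `B` are therefore corrected by `f 1 1`, which is central since it lies in `Ker d`.
-/
instance : One F.Grp := ⟨⟨(F.f 1 1)⁻¹, 1⟩⟩

instance : Inv F.Grp :=
  ⟨fun a => ⟨(F.f 1 1)⁻¹ * (X.θ (F.y a.right⁻¹) a.left * F.f a.right⁻¹ a.right)⁻¹, a.right⁻¹⟩⟩

@[simp] theorem left_mul (a b : F.Grp) :
    (a * b).left = a.left * X.θ (F.y a.right) b.left * F.f a.right b.right := rfl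

@[simp] theorem right_mul (a b : F.Grp) : (a * b).right = a.right * b.right := rfl

@[simp] theorem left_one : (1 : F.Grp).left = (F.f 1 1)⁻¹ := rfl

@[simp] theorem right_one : (1 : F.Grp).right = 1 := rfl

@[simp] theorem left_inv (a : F.Grp) : (a⁻¹).left =
    (F.f 1 1)⁻¹ * (X.θ (F.y a.right⁻¹) a.left * F.f a.right⁻¹ a.right)⁻¹ := rfl

@[simp] theorem right_inv (a : F.Grp) : (a⁻¹).right = a.right⁻¹ := rfl

instance : Group F.Grp :=
  Group.ofLeftAxioms
    (fun a b c => by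
      ext
      · simp only [left_mul, right_mul, map_mul, F.θ_y_y]
        -- Solved for `θ_{y p} (f q r)`, the Schreier identity reduces associativity to an identity
        -- in a free group.
        have h := F.f_mul a.right b.right c.right
        rw [eq_comm, ← eq_mul_inv_iff_mul_eq] at h
        rw [h]
        group
      · exact mul_assoc _ _ _)
    (fun a => by
      ext
      · simp only [left_mul, left_one, right_one, F.y_one, map_one, MulAut.one_apply, F.f_one_left]
        rw [mul_assoc, ← F.f_one_comm, inv_mul_cancel_left]
      · exact one_mul _)
    (fun a => by
      ext
      · simp only [left_mul, left_inv, right_inv, left_one]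
        group
      · exact inv_mul_cancel _)

/-- The element of `F.Grp` over `q` with trivial component in `B`. -/
def lift (q : Q) : F.Grp := ⟨1, q⟩

/-- The inclusion `B → F.Grp`. -/
def inl : B →* F.Grp where
  toFun b := ⟨b * (F.f 1 1)⁻¹, 1⟩
  map_one' := by ext <;> simp
  map_mul' b c := by
    ext
    · simp only [left_mul, F.y_one, map_one, MulAut.one_apply]
      rw [mul_assoc (b * _), inv_mul_cancel_right, mul_assoc, mul_assoc, mul_right_inj]
      exact (Commute.inv_left (F.f_one_comm c)).eq.symm
    · simp

theorem inl_mul_lift (b : B) (q : Q) : F.inl b * F.lift q = ⟨b, q⟩ := by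
  ext
  · simp only [inl, lift, left_mul, MonoidHom.coe_mk, OneHom.coe_mk, map_one, mul_one]
    rw [F.f_one_left q, inv_mul_cancel_right]
  · simp [inl, lift]

theorem lift_mul_lift (p q : Q) : F.lift p * F.lift q = F.inl (F.f p q) * F.lift (p * q) := by
  rw [inl_mul_lift]
  ext <;> simp [lift]

theorem lift_mul_inl (q : Q) (b : B) : F.lift q * F.inl b = F.inl (X.θ (F.y q) b) * F.lift q := by
  rw [inl_mul_lift]
  ext
  · simp only [inl, lift, left_mul, MonoidHom.coe_mk, OneHom.coe_mk, one_mul]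
    rw [F.f_one_right q, ← map_mul, inv_mul_cancel_right]
  · simp [inl, lift]

/-- The short exact sequence `1 → B → F.Grp → Q → 1`. -/
def seq : GroupExtension B F.Grp Q where
  inl := F.inl
  rightHom :=
    { toFun := Grp.right
      map_one' := rfl
      map_mul' := fun _ _ => rfl }
  inl_injective b c h := mul_right_cancel (congrArg Grp.left h)
  range_inl_eq_ker_rightHom := by
    ext a
    constructor
    · rintro ⟨b, rfl⟩
      rfl
    · intro h
      exact ⟨a.left * F.f 1 1, Grp.ext (mul_inv_cancel_right _ _) (MonoidHom.mem_ker.mp h).symm⟩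
  rightHom_surjective q := ⟨F.lift q, rfl⟩

/-- The homomorphism `F.Grp → D`. -/
def ε : F.Grp →* D where
  toFun a := X.d a.left * F.y a.right
  map_one' := by simp [F.d_f_one, F.y_one]
  map_mul' a b := by
    simp only [left_mul, right_mul, map_mul, X.d_θ, mul_assoc, ← F.y_mul]
    group

@[simp] theorem ε_inl (b : B) : F.ε (F.inl b) = X.d b := by
  simp [ε, inl, F.d_f_one, F.y_one]

@[simp] theorem ε_lift (q : Q) : F.ε (F.lift q) = F.y q := by
  simp [ε, lift]

/-- The extension of type `X` defined by a factor set. -/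
def extension : X.Extension Q where
  E := F.Grp
  seq := F.seq
  ε := F.ε
  isHom :=
    { comm := F.ε_inl
      equivariant := fun a b => by
        apply F.seq.inl_injective
        show F.seq.inl (F.seq.conjAct a b) = F.inl (X.θ (F.ε a) b)
        rw [F.seq.inl_conjAct_comm, mul_inv_eq_iff_eq_mul]
        -- Splitting the element as `inl c * lift q` leaves two actions: `lift q` acts through `y
        -- q`, and `inl c` acts by conjugation, which is `θ (d c)`.
        obtain ⟨c, q⟩ := a
        show (⟨c, q⟩ : F.Grp) * F.inl b = _
        rw [← F.inl_mul_lift, mul_assoc, F.lift_mul_inl, ← mul_assoc, ← mul_assoc, ← map_mul,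
          ← map_mul, map_mul F.ε, F.ε_inl, F.ε_lift, map_mul X.θ, X.θ_d, MulAut.mul_apply,
          MulAut.conj_apply, inv_mul_cancel_right] }

end FactorSet

/-! ### Factor sets realized by an extension -/

namespace Extension

variable {Q : Type u} [Group Q]

/-- `ℰ` realizes the factor set `F`: there is a set-theoretic section of `ℰ` lying over the
representatives of `F`, whose factors are those of `F`. -/
def Realizes (ℰ : X.Extension Q) (F : FactorSet X Q) : Prop :=
  ∃ e : Q → ℰ.E, (∀ q, ℰ.seq.rightHom (e q) = q) ∧ (∀ q, ℰ.ε (e q) = F.y q) ∧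
    ∀ p q, e p * e q = ℰ.seq.inl (F.f p q) * e (p * q)

theorem _root_.CrossedModule.FactorSet.extension_realizes (F : FactorSet X Q) :
    F.extension.Realizes F :=
  ⟨F.lift, fun _ => rfl, F.ε_lift, F.lift_mul_lift⟩

theorem ε_inl (ℰ : X.Extension Q) (b : B) : ℰ.ε (ℰ.seq.inl b) = X.d b := ℰ.isHom.comm b

theorem mul_inl (ℰ : X.Extension Q) (e : ℰ.E) (b : B) :
    e * ℰ.seq.inl b = ℰ.seq.inl (X.θ (ℰ.ε e) b) * e := by
  rw [← mul_inv_eq_iff_eq_mul, ← ℰ.seq.inl_conjAct_comm]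
  exact congrArg _ (ℰ.isHom.equivariant e b)

theorem exists_inl (ℰ : X.Extension Q) {e e' : ℰ.E}
    (h : ℰ.seq.rightHom e = ℰ.seq.rightHom e') : ∃ b, e = ℰ.seq.inl b * e' := by
  have h' : e * e'⁻¹ ∈ ℰ.seq.inl.range := by
    rw [ℰ.seq.range_inl_eq_ker_rightHom, MonoidHom.mem_ker, map_mul, map_inv, h, mul_inv_cancel]
  obtain ⟨b, hb⟩ := h'
  exact ⟨b, by rw [hb, inv_mul_cancel_right]⟩

theorem Realizes.induces {ℰ : X.Extension Q} {F : FactorSet X Q} (h : ℰ.Realizes F)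
    {ψ : Q →* X.Coker} (hψ : ∀ q, (QuotientGroup.mk (F.y q) : X.Coker) = ψ q) :
    ℰ.Induces ψ := by
  obtain ⟨e, h₁, h₂, -⟩ := h
  intro a
  obtain ⟨b, hb⟩ := ℰ.exists_inl (h₁ (ℰ.seq.rightHom a)).symm
  rw [hb, map_mul, ε_inl, h₂, QuotientGroup.mk_mul, hψ, map_mul, ℰ.seq.rightHom_inl, one_mul, h₁]
  rw [(QuotientGroup.eq_one_iff (N := X.d.range) (X.d b)).mpr ⟨b, rfl⟩, one_mul]

/-- Extensions realizing the same factor set are equivalent. -/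
theorem Realizes.equivalent {ℰ ℰ' : X.Extension Q} {F : FactorSet X Q} (h : ℰ.Realizes F)
    (h' : ℰ'.Realizes F) : ℰ.Equivalent ℰ' := by
  obtain ⟨e, h₁, h₂, h₃⟩ := h
  obtain ⟨e', h₁', h₂', h₃'⟩ := h'
  -- Coordinates: each `a` is uniquely `inl (c a) * e (p a)`. The equivalence keeps the coordinates
  -- and replaces `e` by `e'`.
  choose c hc using fun a : ℰ.E => ℰ.exists_inl (h₁ (ℰ.seq.rightHom a)).symm
  have key : ∀ b q, c (ℰ.seq.inl b * e q) = b := fun b q => by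
    have h := hc (ℰ.seq.inl b * e q)
    rw [map_mul, ℰ.seq.rightHom_inl, one_mul, h₁] at h
    exact (ℰ.seq.inl_injective (mul_right_cancel h)).symm
  let η : ℰ.E → ℰ'.E := fun a => ℰ'.seq.inl (c a) * e' (ℰ.seq.rightHom a)
  have hη : ∀ b q, η (ℰ.seq.inl b * e q) = ℰ'.seq.inl b * e' q := fun b q => by
    simp only [η, key, map_mul, ℰ.seq.rightHom_inl, one_mul, h₁]
  have hmul : ∀ a a', η (a * a') = η a * η a' := by
    have aux : ∀ b p b' q, η (ℰ.seq.inl b * e p * (ℰ.seq.inl b' * e q)) =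
        η (ℰ.seq.inl b * e p) * η (ℰ.seq.inl b' * e q) := fun b p b' q => by
      have t : ℰ.seq.inl b * e p * (ℰ.seq.inl b' * e q) =
          ℰ.seq.inl (b * X.θ (F.y p) b' * F.f p q) * e (p * q) := by
        rw [mul_assoc, ← mul_assoc (e p), ℰ.mul_inl, h₂, mul_assoc _ (e p), h₃]
        simp only [map_mul, mul_assoc]
      rw [t, hη, hη, hη]
      rw [mul_assoc (ℰ'.seq.inl b), ← mul_assoc (e' p), ℰ'.mul_inl, h₂', mul_assoc _ (e' p), h₃']
      simp only [map_mul, mul_assoc]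
    intro a a'
    have := aux (c a) (ℰ.seq.rightHom a) (c a') (ℰ.seq.rightHom a')
    rwa [← hc a, ← hc a'] at this
  -- The sections need not send `1` to `1`, so `inl b` has coordinates `(b * (f 1 1)⁻¹, 1)`.
  have e_one : e 1 = ℰ.seq.inl (F.f 1 1) ∧ e' 1 = ℰ'.seq.inl (F.f 1 1) :=
    ⟨mul_right_cancel (b := e 1) (by simpa only [mul_one] using h₃ 1 1),
      mul_right_cancel (b := e' 1) (by simpa only [mul_one] using h₃' 1 1)⟩
  refine ⟨MonoidHom.mk' η hmul, fun b => ?_, fun a => ?_, fun a => ?_⟩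
  · have := hη (b * (F.f 1 1)⁻¹) 1
    rwa [e_one.1, e_one.2, ← map_mul, ← map_mul, inv_mul_cancel_right] at this
  · show ℰ'.seq.rightHom (η a) = _
    simp [η, h₁']
  · show ℰ'.ε (η a) = _
    conv_rhs => rw [hc a]
    simp only [η, map_mul, ε_inl, h₂, h₂']

/-- A factor set realized by an extension is realized by the equivalent ones. -/
theorem Realizes.of_equivalent {ℰ ℰ' : X.Extension Q} {F : FactorSet X Q} (h : ℰ.Realizes F)
    (hη : ℰ.Equivalent ℰ') : ℰ'.Realizes F := by
  obtain ⟨e, h₁, h₂, h₃⟩ := h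
  obtain ⟨η, hη₁, hη₂, hη₃⟩ := hη
  refine ⟨fun q => η (e q), fun q => by rw [hη₂, h₁], fun q => by rw [hη₃, h₂], fun p q => ?_⟩
  rw [← map_mul, h₃, map_mul, hη₁]

end Extension

/-! ### The factor sets with the representatives of a stick -/

variable {Q : Type u} [Group Q]

/-- `d u = ψ*k` in multiplicative notation, for a 2-cochain `u` with values in `Ker d`. -/
def Cobounds (σ : X.Stick) (ψ : Q →* X.Coker) (u : Q → Q → X.d.ker) : Prop :=
  ∀ p q r, X.act (ψ p) (u q r) * u p (q * r) = σ.k (ψ p) (ψ q) (ψ r) * (u (p * q) r * u p q)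

theorem mul_ker_comm (b : B) (u : X.d.ker) : b * u.1 = u.1 * b := (X.comm_of_mem_ker u.2 b).symm

/-- Values of `u` are central, so they can be collected on the right of each side. The two products
of inverse labels that remain differ by the central factor `k`, by `Stick.k_mul`. -/
theorem schreier_iff (σ : X.Stick) (ψ : Q →* X.Coker) (u : Q → Q → X.d.ker) (p q r : Q) :
    (σ.lab (ψ p) (ψ q))⁻¹ * (u p q).1 * ((σ.lab (ψ (p * q)) (ψ r))⁻¹ * (u (p * q) r).1) =
      X.θ (σ.obj (ψ p)).val ((σ.lab (ψ q) (ψ r))⁻¹ * (u q r).1) *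
        ((σ.lab (ψ p) (ψ (q * r)))⁻¹ * (u p (q * r)).1) ↔
    X.act (ψ p) (u q r) * u p (q * r) =
      σ.k (ψ p) (ψ q) (ψ r) * (u (p * q) r * u p q) := by
  have h := σ.k_mul (ψ p) (ψ q) (ψ r)
  rw [← map_mul, ← map_mul] at h
  have l : (σ.lab (ψ p) (ψ q))⁻¹ * (u p q).1 * ((σ.lab (ψ (p * q)) (ψ r))⁻¹ * (u (p * q) r).1) =
      ((σ.lab (ψ (p * q)) (ψ r) * σ.lab (ψ p) (ψ q))⁻¹) * ((u (p * q) r * u p q : X.d.ker)).1 := by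
    rw [mul_assoc, ← mul_assoc (u p q).1, ← mul_ker_comm, mul_assoc _ (u p q).1, mul_inv_rev,
      ← Subgroup.coe_mul, mul_comm (u p q), mul_assoc]
  have r : X.θ (σ.obj (ψ p)).val ((σ.lab (ψ q) (ψ r))⁻¹ * (u q r).1) *
        ((σ.lab (ψ p) (ψ (q * r)))⁻¹ * (u p (q * r)).1) =
      (σ.lab (ψ p) (ψ (q * r)) * X.θ (σ.obj (ψ p)).val (σ.lab (ψ q) (ψ r)))⁻¹ *
        (X.act (ψ p) (u q r) * u p (q * r) : X.d.ker).1 := by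
    rw [map_mul, ← σ.act_eq, mul_assoc, ← mul_assoc (X.act _ _).1, ← mul_ker_comm,
      mul_assoc _ (X.act _ _).1, mul_inv_rev, ← Subgroup.coe_mul, map_inv, mul_assoc]
  rw [l, r, ← h, mul_inv_rev (σ.k _ _ _).1, mul_assoc, mul_right_inj, ← Subgroup.coe_inv, ← Subgroup.coe_mul,
    Subtype.coe_inj, eq_inv_mul_iff_mul_eq, eq_comm]

/-- The factor set with representatives `x_{ψ q}` and factors `m(ψ p, ψ q)⁻¹ u(p, q)`, where
`d u = ψ*k`. -/
def factorSet (σ : X.Stick) (ψ : Q →* X.Coker) (u : Q → Q → X.d.ker) (hu : Cobounds σ ψ u) :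
    FactorSet X Q where
  y q := (σ.obj (ψ q)).val
  f p q := (σ.lab (ψ p) (ψ q))⁻¹ * (u p q).1
  y_one := by rw [map_one, σ.obj_one]; rfl
  y_mul p q := by
    rw [map_mul ψ, σ.lab_eq, map_mul, map_inv, MonoidHom.mem_ker.mp (u p q).2]
    group
  f_mul p q r := (schreier_iff σ ψ u p q r).mpr (hu p q r)

theorem mk_factorSet_y (σ : X.Stick) (ψ : Q →* X.Coker) (u : Q → Q → X.d.ker)
    (hu : Cobounds σ ψ u) (q : Q) :
    (QuotientGroup.mk ((factorSet σ ψ u hu).y q) : X.Coker) = ψ q :=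
  σ.cls_obj (ψ q)

/-- Every extension inducing `ψ` realizes the factor set of some `u` with `d u = ψ*k`. -/
theorem Extension.Induces.exists_realizes {ℰ : X.Extension Q} {ψ : Q →* X.Coker}
    (h : ℰ.Induces ψ) (σ : X.Stick) :
    ∃ (u : Q → Q → X.d.ker) (hu : Cobounds σ ψ u), ℰ.Realizes (factorSet σ ψ u hu) := by
  have hs : ∀ q, ∃ e : ℰ.E, ℰ.seq.rightHom e = q ∧ ℰ.ε e = (σ.obj (ψ q)).val := fun q => by
    obtain ⟨e, rfl⟩ := ℰ.seq.rightHom_surjective q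
    have h' := (h e).trans (σ.cls_obj _).symm
    -- `ε e` and `x_{ψ q}` lie in the same coset of `d(B)`; multiplying `e` by `inl b` moves one to
    -- the other without changing the image in `Q`.
    obtain ⟨b, hb⟩ := QuotientGroup.eq.mp h'
    refine ⟨e * ℰ.seq.inl b, by simp, ?_⟩
    rw [map_mul, ℰ.ε_inl, hb, mul_inv_cancel_left]
  choose e h₁ h₂ using hs
  have hf : ∀ p q, ∃ b, e p * e q = ℰ.seq.inl b * e (p * q) := fun p q =>
    ℰ.exists_inl (by rw [map_mul, h₁, h₁, h₁])
  choose f h₃ using hf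
  have hu : ∀ p q, σ.lab (ψ p) (ψ q) * f p q ∈ X.d.ker := fun p q => by
    have h := congrArg ℰ.ε (h₃ p q)
    rw [map_mul, map_mul, ℰ.ε_inl, h₂, h₂, h₂, map_mul ψ, σ.lab_eq, ← mul_assoc,
      right_eq_mul] at h
    rw [MonoidHom.mem_ker, map_mul]
    exact mul_eq_one_comm.mp h
  let u : Q → Q → X.d.ker := fun p q => ⟨_, hu p q⟩
  have hfu : ∀ p q, (σ.lab (ψ p) (ψ q))⁻¹ * (u p q).1 = f p q := fun p q =>
    inv_mul_cancel_left _ _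
  refine ⟨u, fun p q r => ?_, e, h₁, h₂, fun p q => ?_⟩
  · rw [← schreier_iff]
    simp only [hfu]
    apply ℰ.seq.inl_injective
    -- The Schreier identity comes from expanding `e p * e q * e r` with either bracketing.
    apply mul_right_cancel (b := e (p * q * r))
    calc _ = e p * e q * e r := by
          rw [h₃ p q, mul_assoc (ℰ.seq.inl _), h₃ (p * q) r, map_mul, mul_assoc (ℰ.seq.inl _)]
      _ = _ := by
        rw [mul_assoc (e p), h₃ q r, ← mul_assoc (e p), ℰ.mul_inl, h₂, mul_assoc (ℰ.seq.inl _),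
          h₃ p, map_mul, mul_assoc p, mul_assoc (ℰ.seq.inl _)]
  · rw [h₃]
    exact congrArg (fun b => ℰ.seq.inl b * e (p * q)) (hfu p q).symm

/-- The coboundary of a 1-cochain with values in `Ker d`, in multiplicative notation, relates two
2-cochains. -/
def Cohomologous (ψ : Q →* X.Coker) (u u' : Q → Q → X.d.ker) : Prop :=
  ∃ h : Q → X.d.ker, ∀ p q, u p q * h (p * q) = h p * X.act (ψ p) (h q) * u' p q

/-- The effect on the factors of rescaling a section by central elements. Absorbing `h (p * q)` on
the right then turns the change into a coboundary. -/
theorem section_mul_section {ℰ : X.Extension Q} {σ : X.Stick} {ψ : Q →* X.Coker}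
    {u' : Q → Q → X.d.ker} {e' : Q → ℰ.E} (h : Q → X.d.ker)
    (h₂ : ∀ q, ℰ.ε (e' q) = (σ.obj (ψ q)).val)
    (h₃ : ∀ p q, e' p * e' q = ℰ.seq.inl ((σ.lab (ψ p) (ψ q))⁻¹ * (u' p q).1) * e' (p * q))
    (p q : Q) :
    ℰ.seq.inl (h p).1 * e' p * (ℰ.seq.inl (h q).1 * e' q) =
      ℰ.seq.inl ((σ.lab (ψ p) (ψ q))⁻¹ * (h p * X.act (ψ p) (h q) * u' p q : X.d.ker).1) *
        e' (p * q) := by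
  rw [mul_assoc, ← mul_assoc (e' p), ℰ.mul_inl, h₂, ← σ.act_eq, mul_assoc _ (e' p), h₃,
    ← mul_assoc, ← mul_assoc, ← map_mul, ← map_mul, ← Subgroup.coe_mul, ← mul_assoc,
    ← mul_ker_comm, mul_assoc, ← Subgroup.coe_mul]

/-- Extensions realizing the factor sets of `u` and `u'` are equivalent iff `u` and `u'` are
cohomologous. -/
theorem Extension.Realizes.equivalent_iff {ℰ ℰ' : X.Extension Q} {σ : X.Stick} {ψ : Q →* X.Coker}
    {u u' : Q → Q → X.d.ker} {hu : Cobounds σ ψ u} {hu' : Cobounds σ ψ u'}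
    (hℰ : ℰ.Realizes (factorSet σ ψ u hu)) (hℰ' : ℰ'.Realizes (factorSet σ ψ u' hu')) :
    ℰ.Equivalent ℰ' ↔ Cohomologous ψ u u' := by
  constructor
  · intro hη
    obtain ⟨e, h₁, h₂, h₃⟩ := hℰ.of_equivalent hη
    obtain ⟨e', h₁', h₂', h₃'⟩ := hℰ'
    choose h hh using fun q => ℰ'.exists_inl ((h₁ q).trans (h₁' q).symm)
    -- Both sections lie over the same representatives in `D`, so `d (h q)` is trivial.
    have hk : ∀ q, h q ∈ X.d.ker := fun q => by
      have t := congrArg ℰ'.ε (hh q)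
      rw [map_mul, ℰ'.ε_inl, h₂, h₂'] at t
      exact right_eq_mul.mp t
    refine ⟨fun q => ⟨h q, hk q⟩, fun p q => ?_⟩
    have t := section_mul_section (fun q => ⟨h q, hk q⟩) h₂' h₃' p q
    simp only [← hh] at t
    rw [h₃, hh (p * q), ← mul_assoc, ← map_mul] at t
    have t' := ℰ'.seq.inl_injective (mul_right_cancel t)
    apply Subtype.ext
    simp only [factorSet, mul_assoc] at t'
    exact mul_left_cancel (t'.trans (by simp only [Subgroup.coe_mul, mul_assoc]))
  · rintro ⟨h, hh⟩
    refine hℰ.equivalent ?_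
    obtain ⟨e', h₁', h₂', h₃'⟩ := hℰ'
    refine ⟨fun q => ℰ'.seq.inl (h q).1 * e' q, fun q => ?_, fun q => ?_, fun p q => ?_⟩
    · rw [map_mul, ℰ'.seq.rightHom_inl, one_mul, h₁']
    · rw [map_mul, ℰ'.ε_inl, MonoidHom.mem_ker.mp (h q).2, one_mul, h₂']
      rfl
    · refine (section_mul_section h h₂' h₃' p q).trans ?_
      rw [← hh, ← mul_assoc, ← map_mul, Subgroup.coe_mul, ← mul_assoc]
      rfl

end CrossedModule

/-! ### Vanishing of cohomology classes in positive degree -/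

namespace groupCohomology

/-- A cocycle of positive degree is zero in cohomology iff it is the differential of a cochain. -/
theorem π_succ_eq_zero_iff {k G : Type u} [CommRing k] [Group G] (A : Rep.{u} k G) (n : ℕ)
    (z : cocycles A (n + 1)) :
    π A (n + 1) z = 0 ↔
      ∃ u, (inhomogeneousCochains A).d n (n + 1) u = iCocycles A (n + 1) z := by
  have hex := ShortComplex.exact_of_g_is_cokernel
    (ShortComplex.mk _ _ ((inhomogeneousCochains A).toCycles_comp_homologyπ n (n + 1)))
    ((inhomogeneousCochains A).homologyIsCokernel n (n + 1) (by simp))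
  rw [ShortComplex.moduleCat_exact_iff] at hex
  have hi : ∀ u, iCocycles A (n + 1) (toCocycles A n (n + 1) u) =
      (inhomogeneousCochains A).d n (n + 1) u := fun u => by
    rw [← ConcreteCategory.comp_apply, HomologicalComplex.toCycles_i]
  constructor
  · intro h
    obtain ⟨u, hu⟩ := hex z h
    exact ⟨u, by rw [← hi]; exact congrArg _ hu⟩
  · rintro ⟨u, hu⟩
    rw [← hi] at hu
    -- Equality of underlying cochains lifts to cocycles because the inclusion of cocycles is
    -- injective.
    have hz := (ModuleCat.mono_iff_injective (iCocycles A (n + 1))).mp inferInstance hu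
    rw [← hz]
    exact ConcreteCategory.congr_hom
      ((inhomogeneousCochains A).toCycles_comp_homologyπ n (n + 1)) u

end groupCohomology

namespace CrossedModule

open groupCohomology

variable {B D Q : Type u} [Group B] [Group D] [Group Q] {X : CrossedModule B D}

/-! ### Comparison with group cohomology -/

theorem iCocycles_cocyclesMap_cocycle (σ : X.Stick) (ψ : Q →* X.Coker) :
    iCocycles (X.kerRes ψ) 3 (cocyclesMap ψ (𝟙 (X.kerRes ψ)) 3 σ.cocycle) =
      fun g : Fin 3 → Q =>
        (Additive.ofMul (σ.k (ψ (g 0)) (ψ (g 1)) (ψ (g 2))) : Additive X.d.ker) := by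
  have h : iCocycles X.kerRep 3 σ.cocycle = fun g : Fin 3 → X.Coker =>
      (Additive.ofMul (σ.k (g 0) (g 1) (g 2)) : Additive X.d.ker) := by
    unfold Stick.cocycle
    exact iCocycles_mk _ _
  rw [← ConcreteCategory.comp_apply, HomologicalComplex.cyclesMap_i, ConcreteCategory.comp_apply,
    h]
  rfl

/-- The multiplicative 2-cochain `Q → Q → Ker d` of an additive one. -/
def mulCochain {ψ : Q →* X.Coker} (v : Q × Q → X.kerRes ψ) (p q : Q) : X.d.ker :=
  Additive.toMul (v (p, q) : Additive X.d.ker)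

/-- The additive form of a multiplicative 2-cochain. -/
def addCochain (ψ : Q →* X.Coker) (u : Q → Q → X.d.ker) (g : Q × Q) : X.kerRes ψ :=
  (Additive.ofMul (u g.1 g.2) : Additive X.d.ker)

/-- `ψ*k` as a function on `Q × Q × Q`. -/
noncomputable def pullback (σ : X.Stick) (ψ : Q →* X.Coker) (g : Q × Q × Q) : X.kerRes ψ :=
  (Additive.ofMul (σ.k (ψ g.1) (ψ g.2.1) (ψ g.2.2)) : Additive X.d.ker)

theorem cobounds_iff (σ : X.Stick) (ψ : Q →* X.Coker) (v : Q × Q → X.kerRes ψ) :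
    Cobounds σ ψ (mulCochain v) ↔ d₂₃ (X.kerRes ψ) v = pullback σ ψ := by
  rw [funext_iff, Prod.forall]
  refine forall_congr' fun p => ?_
  rw [Prod.forall]
  refine forall_congr' fun q => forall_congr' fun r => ?_
  -- Once the negative terms are moved across, the two sides agree by unfolding `Additive`.
  rw [d₂₃_hom_apply, sub_eq_iff_eq_add, sub_add_eq_add_sub, sub_eq_iff_eq_add, add_assoc,
    add_comm (v (p, q))]
  exact Iff.rfl

theorem obstruction_eq_zero_iff (σ : X.Stick) (ψ : Q →* X.Coker) :
    obstruction σ ψ = 0 ↔ ∃ v : Q × Q → X.kerRes ψ, Cobounds σ ψ (mulCochain v) := by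
  have hk : (cochainsIso₃ (X.kerRes ψ)).inv (pullback σ ψ) =
      iCocycles (X.kerRes ψ) 3 (cocyclesMap ψ (𝟙 (X.kerRes ψ)) 3 σ.cocycle) := by
    rw [iCocycles_cocyclesMap_cocycle]
    rfl
  simp only [cobounds_iff]
  rw [obstruction, π_succ_eq_zero_iff, ← hk]
  have hinv := (ModuleCat.mono_iff_injective (cochainsIso₃ (X.kerRes ψ)).inv).mp inferInstance
  constructor
  · rintro ⟨u, hu⟩
    refine ⟨(cochainsIso₂ _).hom u, hinv ?_⟩
    rw [← hu, ← eq_d₂₃_comp_inv_apply, Iso.hom_inv_id_apply]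
  · rintro ⟨v, hv⟩
    exact ⟨(cochainsIso₂ _).inv v, by rw [eq_d₂₃_comp_inv_apply, hv]⟩

theorem cohomologous_iff (ψ : Q →* X.Coker) (v v' : Q × Q → X.kerRes ψ) :
    Cohomologous ψ (mulCochain v) (mulCochain v') ↔ v - v' ∈ coboundaries₂ (X.kerRes ψ) := by
  -- Here `a = p • h q`, `b = h (p * q)` and `c = h p`, so `a - b + c` is the differential of `h`.
  have aux : ∀ a b c x y : X.kerRes ψ, x + b = c + a + y ↔ a - b + c = x - y :=
    fun a b c x y => by
      rw [eq_sub_iff_add_eq, ← add_sub_right_comm, ← add_sub_right_comm, sub_eq_iff_eq_add,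
        add_comm c, eq_comm]
  refine exists_congr fun h => ?_
  rw [funext_iff, Prod.forall]
  exact forall_congr' fun p => forall_congr' fun q => aux _ _ _ _ _

/-! ### Characteristic classes and the classification -/

/-- The relation between an extension and its characteristic class relative to `v`. -/
def HasClass (σ : X.Stick) (ψ : Q →* X.Coker) (v : Q × Q → X.kerRes ψ) (ℰ : X.Extension Q)
    (c : groupCohomology (X.kerRes ψ) 2) : Prop :=
  ∃ (z : cocycles₂ (X.kerRes ψ)) (hz : Cobounds σ ψ (mulCochain (v + z.1))),
    ℰ.Realizes (factorSet σ ψ _ hz) ∧ H2π _ z = c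

/-- The base point `v` cancels in the difference of the two cochains. This one equivalence gives
independence of choices, invariance under equivalence and injectivity. -/
theorem HasClass.equivalent_iff {σ : X.Stick} {ψ : Q →* X.Coker} {v : Q × Q → X.kerRes ψ}
    {ℰ ℰ' : X.Extension Q} {c c' : groupCohomology (X.kerRes ψ) 2} (h : HasClass σ ψ v ℰ c)
    (h' : HasClass σ ψ v ℰ' c') : ℰ.Equivalent ℰ' ↔ c = c' := by
  obtain ⟨z, hz, hr, rfl⟩ := h
  obtain ⟨z', hz', hr', rfl⟩ := h'
  rw [hr.equivalent_iff hr', cohomologous_iff, H2π_eq_iff, add_sub_add_left_eq_sub]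
  exact Iff.rfl

theorem exists_hasClass {σ : X.Stick} {ψ : Q →* X.Coker} {v : Q × Q → X.kerRes ψ}
    (hv : Cobounds σ ψ (mulCochain v)) {ℰ : X.Extension Q} (h : ℰ.Induces ψ) :
    ∃ c, HasClass σ ψ v ℰ c := by
  obtain ⟨u, hu, hr⟩ := h.exists_realizes σ
  have hu' : d₂₃ _ (addCochain ψ u) = pullback σ ψ := (cobounds_iff σ ψ _).mp hu
  have hz : addCochain ψ u - v ∈ cocycles₂ (X.kerRes ψ) := by
    rw [cobounds_iff] at hv
    exact LinearMap.mem_ker.mpr ((map_sub _ _ _).trans (sub_eq_zero.mpr (hu'.trans hv.symm)))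
  have hadd : v + (addCochain ψ u - v) = addCochain ψ u := add_sub_cancel _ _
  -- The factor set depends on the proof of `Cobounds`, so the equality `hadd` is transported by
  -- generalizing the cochain.
  have key : ∀ w (_ : w = addCochain ψ u), ∃ hw : Cobounds σ ψ (mulCochain w),
      ℰ.Realizes (factorSet σ ψ _ hw) := by
    rintro _ rfl
    exact ⟨hu, hr⟩
  obtain ⟨hw, hr'⟩ := key _ hadd
  exact ⟨_, ⟨_, hz⟩, hw, hr', rfl⟩

theorem exists_induces_hasClass {σ : X.Stick} {ψ : Q →* X.Coker} {v : Q × Q → X.kerRes ψ}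
    (hv : Cobounds σ ψ (mulCochain v)) (c : groupCohomology (X.kerRes ψ) 2) :
    ∃ ℰ : X.Extension Q, ℰ.Induces ψ ∧ HasClass σ ψ v ℰ c := by
  induction c using H2_induction_on with
  | h z =>
    have hz : Cobounds σ ψ (mulCochain (v + z.1)) := by
      rw [cobounds_iff] at hv ⊢
      exact (map_add _ _ _).trans (by rw [hv, LinearMap.mem_ker.mp z.2, add_zero])
    exact ⟨_, (factorSet σ ψ _ hz).extension_realizes.induces (mk_factorSet_y σ ψ _ hz), z, hz,
      (factorSet σ ψ _ hz).extension_realizes, rfl⟩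

theorem nonempty_ext_equiv {σ : X.Stick} {ψ : Q →* X.Coker} {v : Q × Q → X.kerRes ψ}
    (hv : Cobounds σ ψ (mulCochain v)) :
    Nonempty (X.Ext ψ ≃ groupCohomology (X.kerRes ψ) 2) := by
  choose c hc using fun ℰ : X.ExtInducing ψ => exists_hasClass hv ℰ.2
  refine ⟨Equiv.ofBijective (Quotient.lift c fun ℰ ℰ' h => ((hc ℰ).equivalent_iff (hc ℰ')).mp h)
    ⟨?_, fun x => ?_⟩⟩
  · rintro ⟨ℰ⟩ ⟨ℰ'⟩ h
    exact Quotient.sound (((hc ℰ).equivalent_iff (hc ℰ')).mpr h)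
  · obtain ⟨ℰ, hψ, hx⟩ := exists_induces_hasClass hv x
    -- The chosen class of `ℰ` agrees with `x` because `ℰ` is equivalent to itself.
    exact ⟨Quotient.mk _ ⟨ℰ, hψ⟩, ((hc ⟨ℰ, hψ⟩).equivalent_iff hx).mp
      ⟨MonoidHom.id _, fun _ => rfl, fun _ => rfl, fun _ => rfl⟩⟩

end CrossedModule

theorem mainTheorem2 {B D Q : Type u} [Group B] [Group D] [Group Q] (X : CrossedModule B D)
    (σ : X.Stick) (ψ : Q →* X.Coker) :
    (CrossedModule.obstruction σ ψ = 0 ↔ ∃ ℰ : X.Extension Q, ℰ.Induces ψ) ∧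
    (CrossedModule.obstruction σ ψ = 0 →
      Nonempty (X.Ext ψ ≃ groupCohomology (X.kerRes ψ) 2)) := by
  rw [CrossedModule.obstruction_eq_zero_iff]
  refine ⟨⟨?_, ?_⟩, ?_⟩
  · rintro ⟨v, hv⟩
    exact ⟨_, (CrossedModule.factorSet σ ψ _ hv).extension_realizes.induces
      (CrossedModule.mk_factorSet_y σ ψ _ hv)⟩
  · rintro ⟨ℰ, hψ⟩
    obtain ⟨u, hu, -⟩ := hψ.exists_realizes σ
    exact ⟨CrossedModule.addCochain ψ u, hu⟩
  · rintro ⟨v, hv⟩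
    exact CrossedModule.nonempty_ext_equiv hv
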